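/- **Theorem.** Let $X$ be a Banach space and let $A:\mathcal D(A)\subset X\to X$ be the infinitesimal generator of a $C_0$-semigroup $T(t)$, $t\ge 0$, with $\|T(t)\|\le Ke^{\alpha t}$ for all $t\ge 0$, where $K\ge 1$ and $\alpha\in\mathbb R$. Let $B:\mathbb R\to L(X)$ be continuous in the operator norm and such that, for each $t\in\mathbb R$, $B(t)$ maps $X$ into $\mathcal D(A)$, $AB(t)$ is a bounded operator, and $B(t)A$ extends from $\mathcal D(A)$ to a bounded operator on $X$. Let $h,M,\delta$ be positive numbers and put $C_t(u)=\int_t^u B(\tau)\,d\tau$. Suppose that for all $t,u\in\mathbb R$ with $|u-t|\le h$ the operator $C_t(u)$ maps $X$ into $\mathcal D(A)$, $C_t(u)A$ extends to a bounded operator on $X$, and $$\|C_t(u)\|\le\delta,\qquad \|C_t(u)B(u)\|\le M\delta,\qquad \|C_t(u)A\|\le M\delta,\qquad \|AC_t(u)\|\le M\delta .$$ A solution on $[s,\infty)$ of $$\dot y=Ay+B(t)y \qquad (*)$$ is understood in the mild sense: a continuous $y:[s,\infty)\to X$ such that, for all $t\ge s$, $\int_s^t y(r)\,dr\in\mathcal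 D(A)$ and $y(t)=y(s)+A\int_s^t y(r)\,dr+\int_s^t B(r)y(r)\,dr$. The evolution operator of $(*)$ is the family $S(t,s)\in L(X)$, $t\ge s$, with $S(s,s)=I$, $S(t,r)S(r,s)=S(t,s)$ for $t\ge r\ge s$, $(t,s)\mapsto S(t,s)x$ continuous for each $x\in X$, and $t\mapsto S(t,s)x$ a solution of $(*)$ on $[s,\infty)$ for all $s\in\mathbb R$, $x\in X$. Then $(*)$ has a unique evolution operator $S(t,s)$, and $$\|S(t,s)\|\le(1+\delta)K e^{\beta(t-s)}\quad\text{for all } t\ge s,\qquad\text{where } \beta=\alpha+3MK\delta+\frac{\log((1+\delta)K)}{h}.$$ If $\beta<0$, then $(*)$ is asymptotically stable: for every $s\in\mathbb R$ and $\varepsilon>0$ there is $\eta>0$ such that every solution $y$ on $[s,\infty)$ with $\|y(s)\|<\eta$ satisfies $\|y(t)\|<\varepsilon$ for all $t\ge s$, and every solution on $[s,\infty)$ tends to $0$ as $t\to\infty$. -/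

import Mathlib

open Set Filter Topology

noncomputable section

namespace EvolutionStability

section Defs

variable {𝕜 X : Type*} [RCLike 𝕜] [NormedAddCommGroup X] [NormedSpace 𝕜 X] [NormedSpace ℝ X]
  [IsScalarTower ℝ 𝕜 X]

/-- `T` is a `C₀`-semigroup of bounded operators on `X` (only times `t ≥ 0` matter). -/
structure IsC0Semigroup (T : ℝ → X →L[𝕜] X) : Prop where
  zero : T 0 = ContinuousLinearMap.id 𝕜 X
  add : ∀ s t : ℝ, 0 ≤ s → 0 ≤ t → T (s + t) = (T s).comp (T t)
  tendsto_zero : ∀ x : X, Tendsto (fun t => T t x) (𝓝[>] 0) (𝓝 x)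

/-- `A` (with its domain) is the infinitesimal generator of `T`: `x ∈ D(A)` and `A x = y` if and
only if `(T(r) x - x) / r → y` as `r ↓ 0`. -/
def IsGenerator (A : X →ₗ.[𝕜] X) (T : ℝ → X →L[𝕜] X) : Prop :=
  ∀ x y : X, (x, y) ∈ A.graph ↔ Tendsto (fun r : ℝ => r⁻¹ • (T r x - x)) (𝓝[>] 0) (𝓝 y)

/-- `D` is the operator `A C`: `C` maps `X` into `D(A)` and `A (C x) = D x` for all `x`. -/
def IsLeftProduct (A : X →ₗ.[𝕜] X) (C D : X →L[𝕜] X) : Prop :=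
  ∀ x : X, (C x, D x) ∈ A.graph

/-- `E` is a bounded extension to all of `X` of the operator `C A`, which is defined on `D(A)`. -/
def IsRightProduct (A : X →ₗ.[𝕜] X) (C E : X →L[𝕜] X) : Prop :=
  ∀ x : A.domain, E x = C (A x)

/-- `C_t(u) = ∫_t^u B(τ) dτ`, an integral in the Banach space of bounded operators. -/
def primitive (B : ℝ → X →L[𝕜] X) (t u : ℝ) : X →L[𝕜] X :=
  ∫ τ in t..u, B τ

/-- `y` is a (mild) solution of `y' = A y + B(t) y` on `[s, ∞)`: it is continuous there, and for
every `t ≥ s` one has `∫_s^t y ∈ D(A)` and `y(t) = y(s) + A ∫_s^t y(r) dr + ∫_s^t B(r) y(r) dr`. -/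
def IsSolution (A : X →ₗ.[𝕜] X) (B : ℝ → X →L[𝕜] X) (s : ℝ) (y : ℝ → X) : Prop :=
  ContinuousOn y (Ici s) ∧
    ∀ t, s ≤ t → (∫ r in s..t, y r, y t - y s - ∫ r in s..t, B r (y r)) ∈ A.graph

/-- `S(t, s)`, `t ≥ s`, is the evolution operator of `y' = A y + B(t) y`: a strongly continuous
evolution family whose orbits `t ↦ S(t, s) x` solve the equation (`S(t, s)` is irrelevant for
`t < s`). -/
structure IsEvolutionOperator (A : X →ₗ.[𝕜] X) (B : ℝ → X →L[𝕜] X)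
    (S : ℝ → ℝ → X →L[𝕜] X) : Prop where
  self : ∀ s, S s s = ContinuousLinearMap.id 𝕜 X
  comp : ∀ s r t, s ≤ r → r ≤ t → (S t r).comp (S r s) = S t s
  continuousOn : ∀ x : X, ContinuousOn (fun p : ℝ × ℝ => S p.1 p.2 x) {p | p.2 ≤ p.1}
  isSolution : ∀ (s : ℝ) (x : X), IsSolution A B s (fun t => S t s x)

/-- Asymptotic stability (of the zero solution) of `y' = A y + B(t) y`: it is stable in the sense
of Lyapunov, and, the equation being linear, every solution tends to zero. -/
def AsymptoticallyStable (A : X →ₗ.[𝕜] X) (B : ℝ → X →L[𝕜] X) : Prop :=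
  (∀ s : ℝ, ∀ ε > 0, ∃ η > 0, ∀ y : ℝ → X, IsSolution A B s y → ‖y s‖ < η →
      ∀ t, s ≤ t → ‖y t‖ < ε) ∧
    ∀ (s : ℝ) (y : ℝ → X), IsSolution A B s y → Tendsto y atTop (𝓝 0)

end Defs

end EvolutionStability

end

open EvolutionStability

/-!
Write `C_t(u) = ∫_t^u B`, so that `C_t(t) = 0` and `d/du C_t(u) = B(u)`. Along a solution `y`, the
curve `u ↦ T(t - u) (I - C_t(u)) y(u)` therefore joins `T(t - s) (I - C_t(s)) y(s)` to `y(t)`, and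
in its derivative the term `B(u) y(u)` cancels: what remains is `T(t - u)` applied to
`(A C_t(u) - C_t(u) A - C_t(u) B(u)) y(u)`, which involves only the small averages of `B`.
Integrating and applying Gronwall's inequality to `exp(-α u) ‖y(u)‖` bounds the growth over a time
step of length at most `h` by the factor `(1 + δ) K exp((α + 3 M K δ) (t - s))`. Each further step
of length `h` contributes one more factor `(1 + δ) K`, which is the logarithmic term of `β`.

Mild solutions are handled through Duhamel's formula. It identifies the mild solutions of
`w' = A w + f`, because a mild solution `w` with `f = 0` and `w(s) = 0` has an integral `W` with
`W' = A W`, and then `T(t - u) W(u)` is constant in `u`. The evolution operator itself is the sum of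
the Dyson series, which converges locally uniformly in both time variables.
-/

namespace EvolutionStability

section Gronwall

variable {v : ℝ → ℝ} {s t : ℝ}

theorem le_mul_exp_of_le_add_mul_integral {a c : ℝ} (hv : Continuous v) (hv0 : ∀ r, 0 ≤ v r)
    (hc : 0 ≤ c) (hst : s ≤ t) (hle : ∀ r ∈ Icc s t, v r ≤ a + c * ∫ σ in s..r, v σ) :
    v t ≤ a * Real.exp (c * (t - s)) := by
  have ha : 0 ≤ a := (hv0 s).trans (by simpa using hle s ⟨le_rfl, hst⟩)
  have hderiv (r : ℝ) : HasDerivAt (fun r => a + c * ∫ σ in s..r, v σ) (c * v r) r :=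
    ((hv.integral_hasStrictDerivAt s r).hasDerivAt.const_mul c).const_add a
  have hgronwall := norm_le_gronwallBound_of_norm_deriv_right_le (δ := a) (K := c) (ε := 0)
    (fun r _ => (hderiv r).continuousAt.continuousWithinAt)
    (fun r _ => (hderiv r).hasDerivWithinAt) (by simp [abs_of_nonneg ha])
    (fun r hr => by
      have hr' := hle r ⟨hr.1, hr.2.le⟩
      rw [Real.norm_of_nonneg (mul_nonneg hc (hv0 r)),
        Real.norm_of_nonneg ((hv0 r).trans hr'), add_zero]
      exact mul_le_mul_of_nonneg_left hr' hc) t ⟨hst, le_rfl⟩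
  rw [gronwallBound_ε0] at hgronwall
  exact (hle t ⟨hst, le_rfl⟩).trans ((Real.le_norm_self _).trans hgronwall)

theorem le_mul_exp_of_le_exp_add_mul_integral_exp {a c α : ℝ} (hv : Continuous v)
    (hv0 : ∀ r, 0 ≤ v r) (hc : 0 ≤ c) (hst : s ≤ t)
    (hle : ∀ r ∈ Icc s t, v r ≤
      a * Real.exp (α * (r - s)) + c * ∫ σ in s..r, Real.exp (α * (r - σ)) * v σ) :
    v t ≤ a * Real.exp ((α + c) * (t - s)) := by
  have hexp (p q r : ℝ) :
      Real.exp (α * (p - q)) * Real.exp (α * (q - r)) = Real.exp (α * (p - r)) := by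
    rw [← Real.exp_add]; ring_nf
  have hweighted : Real.exp (α * (s - t)) * v t ≤ a * Real.exp (c * (t - s)) := by
    refine le_mul_exp_of_le_add_mul_integral (v := fun r => Real.exp (α * (s - r)) * v r)
      (by fun_prop) (fun r => mul_nonneg (Real.exp_pos _).le (hv0 r)) hc hst fun r hr => ?_
    calc Real.exp (α * (s - r)) * v r
        ≤ Real.exp (α * (s - r)) *
          (a * Real.exp (α * (r - s)) + c * ∫ σ in s..r, Real.exp (α * (r - σ)) * v σ) := by
          gcongr; exact hle r hr
      _ = a * (Real.exp (α * (s - r)) * Real.exp (α * (r - s))) +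
          c * ∫ σ in s..r, Real.exp (α * (s - r)) * Real.exp (α * (r - σ)) * v σ := by
          simp only [mul_assoc, intervalIntegral.integral_const_mul]; ring
      _ = a + c * ∫ σ in s..r, Real.exp (α * (s - σ)) * v σ := by
          simp only [hexp, sub_self, mul_zero, Real.exp_zero, mul_one]
  calc v t = Real.exp (α * (t - s)) * (Real.exp (α * (s - t)) * v t) := by
        rw [← mul_assoc, hexp, sub_self, mul_zero, Real.exp_zero, one_mul]
    _ ≤ Real.exp (α * (t - s)) * (a * Real.exp (c * (t - s))) := by gcongr
    _ = a * Real.exp ((α + c) * (t - s)) := by rw [add_mul, Real.exp_add]; ring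

theorem le_mul_exp_of_short_steps {L γ h : ℝ} (hL : 1 ≤ L) (hh : 0 < h) (hvs : 0 ≤ v s)
    (hstep : ∀ a r, s ≤ a → a ≤ r → r - a ≤ h → v r ≤ L * Real.exp (γ * (r - a)) * v a)
    (hst : s ≤ t) : v t ≤ L * Real.exp ((γ + Real.log L / h) * (t - s)) * v s := by
  have hgrid (n : ℕ) : v (s + n * h) ≤ L ^ n * Real.exp (γ * (n * h)) * v s := by
    induction n with
    | zero => simp
    | succ n ih =>
      calc v (s + (n + 1 : ℕ) * h)
          ≤ L * Real.exp (γ * (s + (n + 1 : ℕ) * h - (s + n * h))) * v (s + n * h) :=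
            hstep _ _ (le_add_of_nonneg_right (by positivity)) (by push_cast; linarith)
              (by push_cast; linarith)
        _ ≤ L * Real.exp (γ * (s + (n + 1 : ℕ) * h - (s + n * h))) *
            (L ^ n * Real.exp (γ * (n * h)) * v s) := by gcongr
        _ = L ^ (n + 1) * (Real.exp (γ * h) * Real.exp (γ * (n * h))) * v s := by
            push_cast; ring_nf
        _ = L ^ (n + 1) * Real.exp (γ * ((n + 1 : ℕ) * h)) * v s := by
            rw [← Real.exp_add]; push_cast; ring_nf
  have hquot : 0 ≤ (t - s) / h := div_nonneg (sub_nonneg.2 hst) hh.le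
  obtain ⟨n, hn, hn'⟩ : ∃ n : ℕ, (n : ℝ) ≤ (t - s) / h ∧ (t - s) / h < n + 1 :=
    ⟨_, Nat.floor_le hquot, Nat.lt_floor_add_one _⟩
  rw [div_lt_iff₀ hh, add_mul, one_mul] at hn'
  have hpow : L ^ n ≤ Real.exp (Real.log L / h * (t - s)) := by
    rw [← Real.rpow_natCast, Real.rpow_def_of_pos (one_pos.trans_le hL), Real.exp_le_exp,
      div_mul_comm, mul_comm]
    gcongr
    exact Real.log_nonneg hL
  calc v t ≤ L * Real.exp (γ * (t - (s + n * h))) * v (s + n * h) :=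
        hstep _ _ (le_add_of_nonneg_right (by positivity))
          (by linarith [(le_div_iff₀ hh).1 hn]) (by linarith)
    _ ≤ L * Real.exp (γ * (t - (s + n * h))) * (L ^ n * Real.exp (γ * (n * h)) * v s) := by
        gcongr; exact hgrid n
    _ = L * (L ^ n * (Real.exp (γ * (t - (s + n * h))) * Real.exp (γ * (n * h)))) * v s := by ring
    _ = L * (L ^ n * Real.exp (γ * (t - s))) * v s := by rw [← Real.exp_add]; ring_nf
    _ ≤ L * (Real.exp (Real.log L / h * (t - s)) * Real.exp (γ * (t - s))) * v s := by gcongr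
    _ = L * Real.exp ((γ + Real.log L / h) * (t - s)) * v s := by rw [← Real.exp_add]; ring_nf

end Gronwall

section Semigroup

theorem exists_eventually_opNorm_le_of_tendsto {ι 𝕜 E F : Type*} [NontriviallyNormedField 𝕜]
    [NormedAddCommGroup E] [NormedSpace 𝕜 E] [CompleteSpace E] [NormedAddCommGroup F]
    [NormedSpace 𝕜 F] {l : Filter ι} [l.IsCountablyGenerated] {g : ι → E →L[𝕜] F} {f : E → F}
    (hg : ∀ x, Tendsto (fun i => g i x) l (𝓝 (f x))) : ∃ C, ∀ᶠ i in l, ‖g i‖ ≤ C := by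
  by_contra! hfreq
  obtain ⟨V, hV⟩ := l.exists_antitone_basis
  have hlarge (n : ℕ) : ∃ i ∈ V n, (n : ℝ) < ‖g i‖ :=
    ((hfreq n).and_eventually (hV.mem n)).exists.imp fun _ hi => ⟨hi.2, hi.1⟩
  choose i hiV hi using hlarge
  obtain ⟨C, hC⟩ := banach_steinhaus (g := fun n => g (i n)) fun x =>
    (((hg x).comp (hV.tendsto hiV)).norm.bddAbove_range).imp fun _ h n => h ⟨n, rfl⟩
  obtain ⟨n, hn⟩ := exists_nat_gt C
  exact (hn.trans (hi n)).not_ge (hC n)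

variable {𝕜 X : Type*} [RCLike 𝕜] [NormedAddCommGroup X] [NormedSpace 𝕜 X] {T : ℝ → X →L[𝕜] X}

theorem IsC0Semigroup.apply_zero (hT : IsC0Semigroup T) (x : X) : T 0 x = x := by
  rw [hT.zero, ContinuousLinearMap.id_apply]

theorem IsC0Semigroup.apply_posPart_add (hT : IsC0Semigroup T) {a b : ℝ} (ha : 0 ≤ a)
    (hb : 0 ≤ b) (x : X) : T (a + b)⁺ x = T a (T b⁺ x) := by
  rw [posPart_of_nonneg (add_nonneg ha hb), posPart_of_nonneg hb, hT.add a b ha hb,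
    ContinuousLinearMap.comp_apply]

theorem IsC0Semigroup.tendsto_nhdsGE_zero (hT : IsC0Semigroup T) (x : X) :
    Tendsto (fun t => T t x) (𝓝[≥] 0) (𝓝 x) := by
  rw [← Ioi_insert, nhdsWithin_insert, tendsto_sup, tendsto_pure_left]
  exact ⟨fun U hU => (hT.apply_zero x).symm ▸ mem_of_mem_nhds hU, hT.tendsto_zero x⟩

theorem IsC0Semigroup.norm_apply_sub_apply_le (hT : IsC0Semigroup T) {a b : ℝ} (ha : 0 ≤ a)
    (hb : 0 ≤ b) (x : X) : ‖T b x - T a x‖ ≤ ‖T (min a b)‖ * ‖T |b - a| x - x‖ := by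
  wlog hab : a ≤ b generalizing a b
  · simpa only [norm_sub_rev, min_comm, abs_sub_comm] using this hb ha (le_of_not_ge hab)
  have hadd : T b x = T a (T (b - a) x) := by
    rw [← ContinuousLinearMap.comp_apply, ← hT.add _ _ ha (sub_nonneg.2 hab), add_sub_cancel]
  rw [hadd, ← map_sub, min_eq_left hab, abs_of_nonneg (sub_nonneg.2 hab)]
  exact (T a).le_opNorm _

variable [CompleteSpace X]

theorem IsC0Semigroup.exists_norm_posPart_le (hT : IsC0Semigroup T) (R : ℝ) :
    ∃ κ, ∀ t ≤ R, ‖T t⁺‖ ≤ κ := by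
  obtain ⟨C, hC⟩ := exists_eventually_opNorm_le_of_tendsto hT.tendsto_nhdsGE_zero
  obtain ⟨ε, hε : 0 < ε, hCε⟩ := mem_nhdsGE_iff_exists_Icc_subset.1 hC
  have hpow (n : ℕ) : ∀ t, 0 ≤ t → t ≤ n * ε → ‖T t‖ ≤ C ^ n := by
    have hC0 : 0 ≤ C := (norm_nonneg _).trans (hCε ⟨le_rfl, hε.le⟩)
    induction n with
    | zero =>
      intro t ht htn
      obtain rfl : t = 0 := le_antisymm (by simpa using htn) ht
      simpa [hT.zero] using ContinuousLinearMap.norm_id_le (𝕜 := 𝕜) (E := X)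
    | succ n ih =>
      intro t ht htn
      push_cast at htn
      have hmin : 0 ≤ min t ε := le_min ht hε.le
      have hsub : 0 ≤ t - min t ε := sub_nonneg.2 (min_le_left _ _)
      have hle : t - min t ε ≤ n * ε := by
        rcases le_total t ε with h | h
        · rw [min_eq_left h, sub_self]; positivity
        · rw [min_eq_right h]; linarith
      calc ‖T t‖ = ‖(T (min t ε)).comp (T (t - min t ε))‖ := by
            rw [← hT.add _ _ hmin hsub, add_sub_cancel]
        _ ≤ ‖T (min t ε)‖ * ‖T (t - min t ε)‖ := ContinuousLinearMap.opNorm_comp_le _ _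
        _ ≤ C * C ^ n := by
            gcongr
            exacts [hCε ⟨hmin, min_le_right _ _⟩, ih _ hsub hle]
        _ = C ^ (n + 1) := (pow_succ' C n).symm
  obtain ⟨n, hn⟩ := exists_nat_ge (R⁺ / ε)
  exact ⟨C ^ n, fun t ht =>
    hpow n _ (posPart_nonneg _) ((posPart_mono ht).trans ((div_le_iff₀ hε).1 hn))⟩

theorem IsC0Semigroup.continuous_apply_posPart (hT : IsC0Semigroup T) :
    Continuous fun p : ℝ × X => T p.1⁺ p.2 := by
  rw [continuous_iff_continuousAt]
  rintro ⟨τ, x⟩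
  obtain ⟨κ, hκ⟩ := hT.exists_norm_posPart_le (τ⁺ + 1)
  have hmin (t : ℝ) : ‖T (min τ⁺ t⁺)‖ ≤ κ := by
    simpa only [posPart_of_nonneg (le_min (posPart_nonneg τ) (posPart_nonneg t))] using
      hκ (min τ⁺ t⁺) ((min_le_left _ _).trans (le_add_of_nonneg_right zero_le_one))
  have hgap : Tendsto (fun p : ℝ × X => |p.1⁺ - τ⁺|) (𝓝 (τ, x)) (𝓝[≥] 0) := by
    refine tendsto_nhdsWithin_iff.2 ⟨?_, Eventually.of_forall fun _ => mem_Ici.2 (abs_nonneg _)⟩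
    have : Continuous fun p : ℝ × X => |p.1⁺ - τ⁺| := by fun_prop
    simpa using this.tendsto (τ, x)
  have hbound : Tendsto (fun p : ℝ × X => κ * ‖p.2 - x‖ + κ * ‖T |p.1⁺ - τ⁺| x - x‖)
      (𝓝 (τ, x)) (𝓝 0) := by
    have hfst : Tendsto (fun p : ℝ × X => κ * ‖p.2 - x‖) (𝓝 (τ, x)) (𝓝 0) := by
      have : Continuous fun p : ℝ × X => κ * ‖p.2 - x‖ := by fun_prop
      simpa using this.tendsto (τ, x)
    simpa using
      hfst.add ((((hT.tendsto_nhdsGE_zero x).comp hgap).sub_const x).norm.const_mul κ)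
  rw [ContinuousAt, tendsto_iff_norm_sub_tendsto_zero]
  refine squeeze_zero' (Eventually.of_forall fun _ => norm_nonneg _) ?_ hbound
  filter_upwards [continuous_fst.tendsto (τ, x) (Iic_mem_nhds
    ((le_posPart τ).trans_lt (lt_add_one _)))] with p hp
  calc ‖T p.1⁺ p.2 - T τ⁺ x‖ = ‖T p.1⁺ (p.2 - x) + (T p.1⁺ x - T τ⁺ x)‖ := by
        rw [map_sub, sub_add_sub_cancel]
    _ ≤ ‖T p.1⁺ (p.2 - x)‖ + ‖T p.1⁺ x - T τ⁺ x‖ := norm_add_le _ _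
    _ ≤ κ * ‖p.2 - x‖ + κ * ‖T |p.1⁺ - τ⁺| x - x‖ :=
        add_le_add ((T _).le_of_opNorm_le (hκ _ hp) _)
          ((hT.norm_apply_sub_apply_le (posPart_nonneg _) (posPart_nonneg _) x).trans
            (mul_le_mul_of_nonneg_right (hmin _) (norm_nonneg _)))

theorem IsC0Semigroup.continuous_apply {Y : Type*} [TopologicalSpace Y] (hT : IsC0Semigroup T)
    {a : Y → ℝ} {f : Y → X} (ha : Continuous a) (hf : Continuous f) :
    Continuous fun p => T (a p)⁺ (f p) :=
  hT.continuous_apply_posPart.comp (ha.prodMk hf)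

end Semigroup

section MildSolutions

variable {𝕜 X : Type*} [RCLike 𝕜] [NormedAddCommGroup X] [NormedSpace 𝕜 X] [NormedSpace ℝ X]

/-- `w` is a mild solution of the inhomogeneous equation `w' = A w + f` on `[s, ∞)`. For
convenience `w` is required to be continuous on all of `ℝ`; its values before `s` are otherwise
arbitrary. -/
structure IsMildSolution (A : X →ₗ.[𝕜] X) (f : ℝ → X) (s : ℝ) (w : ℝ → X) : Prop where
  continuous : Continuous w
  mem_graph : ∀ t, s ≤ t → (∫ r in s..t, w r, w t - w s - ∫ r in s..t, f r) ∈ A.graph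

/-- Duhamel's formula `T(t - s) x + ∫_s^t T(t - r) f(r) dr` for the mild solution of
`w' = A w + f`, `w(s) = x`. The positive parts only matter for `t < s`, where they make the
expression continuous in `t`. -/
noncomputable def duhamel (T : ℝ → X →L[𝕜] X) (s : ℝ) (x : X) (f : ℝ → X) (t : ℝ) : X :=
  T (t - s)⁺ x + ∫ r in s..t, T (t - r)⁺ (f r)

/-- The mean over `r ≤ σ ≤ r + ε` of `T(r + ε - σ) f(σ)`, i.e. of the forcing transported to time
`r + ε`. The substitution `σ = r + ε θ` gives it the value `f r` at `ε = 0`. -/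
noncomputable def transportedMean (T : ℝ → X →L[𝕜] X) (f : ℝ → X) (ε r : ℝ) : X :=
  ∫ θ in (0 : ℝ)..1, T (ε * (1 - θ))⁺ (f (r + ε * θ))

variable {A : X →ₗ.[𝕜] X} {T : ℝ → X →L[𝕜] X} {f g w z : ℝ → X} {s t : ℝ}

theorem IsMildSolution.sub (hf : Continuous f) (hg : Continuous g) (hw : IsMildSolution A f s w)
    (hz : IsMildSolution A g s z) :
    IsMildSolution A (fun t => f t - g t) s fun t => w t - z t := by
  refine ⟨hw.continuous.sub hz.continuous, fun t ht => ?_⟩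
  rw [intervalIntegral.integral_sub (hw.continuous.intervalIntegrable _ _)
    (hz.continuous.intervalIntegrable _ _), intervalIntegral.integral_sub
    (hf.intervalIntegrable _ _) (hg.intervalIntegrable _ _)]
  convert A.graph.sub_mem (hw.mem_graph t ht) (hz.mem_graph t ht) using 1
  rw [Prod.mk_sub_mk]
  congr 1
  abel

theorem IsMildSolution.mono (hf : Continuous f) (hw : IsMildSolution A f s w) {a : ℝ}
    (ha : s ≤ a) : IsMildSolution A f a w := by
  refine ⟨hw.continuous, fun t ht => ?_⟩
  rw [← intervalIntegral.integral_interval_sub_left (hw.continuous.intervalIntegrable s t)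
      (hw.continuous.intervalIntegrable s a),
    ← intervalIntegral.integral_interval_sub_left (hf.intervalIntegrable s t)
      (hf.intervalIntegrable s a)]
  convert A.graph.sub_mem (hw.mem_graph t (ha.trans ht)) (hw.mem_graph a ha) using 1
  rw [Prod.mk_sub_mk]
  congr 1
  abel

theorem duhamel_self (hT : IsC0Semigroup T) (s : ℝ) (x : X) (f : ℝ → X) :
    duhamel T s x f s = x := by
  simp [duhamel, hT.apply_zero]

theorem transportedMean_zero [CompleteSpace X] (hT : IsC0Semigroup T) (f : ℝ → X) (r : ℝ) :
    transportedMean T f 0 r = f r := by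
  simp [transportedMean, hT.apply_zero]

variable [CompleteSpace X]

theorem continuous_duhamel (hT : IsC0Semigroup T) (hf : Continuous f) (s : ℝ) (x : X) :
    Continuous (duhamel T s x f) := by
  refine (hT.continuous_apply (by fun_prop) continuous_const).add ?_
  exact intervalIntegral.continuous_parametric_intervalIntegral_of_continuous
    (f := fun t r => T (t - r)⁺ (f r)) (hT.continuous_apply (by fun_prop) (by fun_prop))
    continuous_id

theorem continuous_transportedMean (hT : IsC0Semigroup T) (hf : Continuous f) :
    Continuous fun p : ℝ × ℝ => transportedMean T f p.1 p.2 := by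
  exact intervalIntegral.continuous_parametric_intervalIntegral_of_continuous'
    (f := fun (p : ℝ × ℝ) θ => T (p.1 * (1 - θ))⁺ (f (p.2 + p.1 * θ)))
    (hT.continuous_apply (by fun_prop) (by fun_prop)) 0 1

theorem semigroup_apply_duhamel (hT : IsC0Semigroup T) (hf : Continuous f) (x : X) {r ε : ℝ}
    (hsr : s ≤ r) (hε : 0 ≤ ε) :
    T ε (duhamel T s x f r) = T (r + ε - s)⁺ x + ∫ σ in s..r, T (r + ε - σ)⁺ (f σ) := by
  have hadd {σ : ℝ} (hσ : σ ≤ r) (z : X) : T ε (T (r - σ)⁺ z) = T (r + ε - σ)⁺ z := by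
    rw [← hT.apply_posPart_add hε (sub_nonneg.2 hσ), add_comm r, add_sub_assoc]
  rw [duhamel, map_add, hadd hsr, ← ContinuousLinearMap.intervalIntegral_comp_comm _
    (Continuous.intervalIntegrable (hT.continuous_apply (by fun_prop) hf) s r)]
  congr 1
  refine intervalIntegral.integral_congr fun σ hσ => ?_
  rw [uIcc_of_le hsr] at hσ
  exact hadd hσ.2 _

theorem duhamel_add (hT : IsC0Semigroup T) (hf : Continuous f) (x : X) {r ε : ℝ} (hsr : s ≤ r)
    (hε : 0 ≤ ε) :
    duhamel T s x f (r + ε) = T ε (duhamel T s x f r) + ε • transportedMean T f ε r := by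
  have hc : Continuous fun σ => T (r + ε - σ)⁺ (f σ) := hT.continuous_apply (by fun_prop) hf
  have hmean : ε • transportedMean T f ε r = ∫ σ in r..r + ε, T (r + ε - σ)⁺ (f σ) := by
    have hsub := intervalIntegral.smul_integral_comp_add_mul (a := 0) (b := 1)
      (fun σ => T (r + ε - σ)⁺ (f σ)) ε r
    rw [mul_zero, add_zero, mul_one] at hsub
    simp only [← hsub, transportedMean, mul_sub, mul_one, add_sub_add_left_eq_sub]
  rw [semigroup_apply_duhamel hT hf x hsr hε, hmean, duhamel, add_assoc,
    intervalIntegral.integral_add_adjacent_intervals (hc.intervalIntegrable _ _)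
      (hc.intervalIntegrable _ _)]

theorem semigroup_apply_integral_duhamel (hT : IsC0Semigroup T) (hf : Continuous f) (x : X)
    (hst : s ≤ t) {ε : ℝ} (hε : 0 ≤ ε) :
    T ε (∫ r in s..t, duhamel T s x f r) =
      (∫ r in s..t + ε, duhamel T s x f r) - (∫ r in s..s + ε, duhamel T s x f r) -
        ε • ∫ r in s..t, transportedMean T f ε r := by
  have hw := continuous_duhamel hT hf s x
  have hm : Continuous fun r => ε • transportedMean T f ε r :=
    ((continuous_transportedMean hT hf).comp (Continuous.prodMk_right ε)).const_smul ε
  have hw' : Continuous fun r => duhamel T s x f (r + ε) := hw.comp (continuous_add_const ε)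
  calc T ε (∫ r in s..t, duhamel T s x f r)
      = ∫ r in s..t, T ε (duhamel T s x f r) :=
        (ContinuousLinearMap.intervalIntegral_comp_comm _ (hw.intervalIntegrable s t)).symm
    _ = ∫ r in s..t, (duhamel T s x f (r + ε) - ε • transportedMean T f ε r) := by
        refine intervalIntegral.integral_congr fun r hr => ?_
        rw [uIcc_of_le hst] at hr
        exact eq_sub_of_add_eq (duhamel_add hT hf x hr.1 hε).symm
    _ = (∫ r in s + ε..t + ε, duhamel T s x f r) - ε • ∫ r in s..t, transportedMean T f ε r := by
        rw [intervalIntegral.integral_sub (hw'.intervalIntegrable _ _)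
          (hm.intervalIntegrable _ _), intervalIntegral.integral_smul,
          intervalIntegral.integral_comp_add_right (duhamel T s x f)]
    _ = _ := by
        rw [intervalIntegral.integral_interval_sub_left (hw.intervalIntegrable _ _)
          (hw.intervalIntegrable _ _)]

theorem isMildSolution_duhamel (hT : IsC0Semigroup T) (hA : IsGenerator A T) (hf : Continuous f)
    (s : ℝ) (x : X) : IsMildSolution A f s (duhamel T s x f) := by
  have hw := continuous_duhamel hT hf s x
  refine ⟨hw, fun t hst => (hA _ _).2 ?_⟩
  have hquot (u : ℝ) : Tendsto (fun ε : ℝ => ε⁻¹ •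
      ((∫ r in s..u + ε, duhamel T s x f r) - ∫ r in s..u, duhamel T s x f r))
      (𝓝[>] 0) (𝓝 (duhamel T s x f u)) :=
    (hw.integral_hasStrictDerivAt s u).hasDerivAt.tendsto_slope_zero_right
  have hmean : Tendsto (fun ε => ∫ r in s..t, transportedMean T f ε r) (𝓝[>] 0)
      (𝓝 (∫ r in s..t, f r)) := by
    have hcont := intervalIntegral.continuous_parametric_intervalIntegral_of_continuous'
      (μ := MeasureTheory.volume) (f := transportedMean T f) (continuous_transportedMean hT hf) s t
    simpa only [transportedMean_zero hT] using (hcont.tendsto 0).mono_left nhdsWithin_le_nhds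
  have hlim := ((hquot t).sub (hquot s)).sub hmean
  refine hlim.congr' ?_
  filter_upwards [self_mem_nhdsWithin] with ε (hε : 0 < ε)
  rw [semigroup_apply_integral_duhamel hT hf x hst hε.le, intervalIntegral.integral_same, sub_zero]
  simp only [smul_sub, smul_smul, inv_mul_cancel₀ hε.ne', one_smul]
  abel

end MildSolutions

section Calculus

variable {𝕜 X : Type*} [RCLike 𝕜] [NormedAddCommGroup X] [NormedSpace 𝕜 X]
  {A : X →ₗ.[𝕜] X}

theorem IsRightProduct.apply_of_mem_graph {C E : X →L[𝕜] X} (hE : IsRightProduct A C E) {u v : X}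
    (huv : (u, v) ∈ A.graph) : C v = E u := by
  obtain ⟨z, rfl, rfl⟩ := A.mem_graph_iff.1 huv
  exact (hE z).symm

variable [NormedSpace ℝ X] [CompleteSpace X] {T : ℝ → X →L[𝕜] X}
  {f w : ℝ → X} {r s t : ℝ}

theorem IsGenerator.hasDerivWithinAt_semigroup_apply (hA : IsGenerator A T)
    (hT : IsC0Semigroup T) {z : ℝ → X} {z' a : X} (hrt : r < t)
    (hz : HasDerivWithinAt z z' (Ici r) r) (ha : (z r, a) ∈ A.graph) :
    HasDerivWithinAt (fun ρ => T (t - ρ)⁺ (z ρ)) (T (t - r)⁺ (z' - a)) (Ici r) r := by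
  rw [← hasDerivWithinAt_Ioi_iff_Ici, hasDerivWithinAt_iff_tendsto_slope' self_notMem_Ioi] at hz ⊢
  have hshift : Tendsto (fun ρ => ρ - r) (𝓝[>] r) (𝓝[>] 0) := by
    refine tendsto_nhdsWithin_iff.2 ⟨?_, ?_⟩
    · exact (by simpa using (continuous_sub_right r).tendsto r :
        Tendsto (fun ρ => ρ - r) (𝓝 r) (𝓝 0)).mono_left nhdsWithin_le_nhds
    · filter_upwards [self_mem_nhdsWithin] with ρ (hρ : r < ρ) using sub_pos.2 hρ
  have hquot : Tendsto (fun ρ => (ρ - r)⁻¹ • (T (ρ - r) (z r) - z r)) (𝓝[>] r) (𝓝 a) :=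
    ((hA _ _).1 ha).comp hshift
  have htime : Tendsto (fun ρ => t - ρ) (𝓝[>] r) (𝓝 (t - r)) :=
    ((continuous_sub_left t).tendsto r).mono_left nhdsWithin_le_nhds
  have hlim := (hT.continuous_apply_posPart.tendsto (t - r, z' - a)).comp
    (htime.prodMk_nhds (hz.sub hquot))
  refine hlim.congr' ?_
  filter_upwards [self_mem_nhdsWithin, mem_nhdsWithin_of_mem_nhds (Iio_mem_nhds hrt)]
    with ρ (hρ : r < ρ) (hρt : ρ < t)
  have hsplit : T (t - r)⁺ (z r) = T (t - ρ)⁺ (T (ρ - r) (z r)) := by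
    have hρr := sub_nonneg.2 hρ.le
    have htρ := sub_nonneg.2 hρt.le
    rw [← sub_add_sub_cancel t ρ r, hT.apply_posPart_add htρ hρr, posPart_of_nonneg hρr,
      posPart_of_nonneg htρ]
  simp only [Function.comp_apply, slope_def_module]
  rw [hsplit, ← smul_sub, ← map_sub, ← (T (t - ρ)⁺).map_smul_of_tower, sub_sub_sub_cancel_right]

theorem IsMildSolution.eq_zero (hT : IsC0Semigroup T) (hA : IsGenerator A T)
    (hw : IsMildSolution A 0 s w) (hws : w s = 0) (hst : s ≤ t) : w t = 0 := by
  have hder (u : ℝ) : HasDerivAt (fun u => ∫ r in s..u, w r) (w u) u :=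
    (hw.continuous.integral_hasStrictDerivAt s u).hasDerivAt
  have hgraph (u : ℝ) (hu : s ≤ u) : (∫ r in s..u, w r, w u) ∈ A.graph := by
    simpa [hws] using hw.mem_graph u hu
  have hintegral : ∫ r in s..t, w r = 0 := by
    have hcont : Continuous fun ρ => T (t - ρ)⁺ (∫ r in s..ρ, w r) :=
      hT.continuous_apply (by fun_prop)
        (continuous_iff_continuousAt.2 fun ρ => (hder ρ).continuousAt)
    have hconst := constant_of_has_deriv_right_zero hcont.continuousOn (fun ρ hρ => by
      simpa using hA.hasDerivWithinAt_semigroup_apply hT hρ.2 (hder ρ).hasDerivWithinAt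
        (hgraph ρ hρ.1)) t ⟨hst, le_rfl⟩
    simpa [hT.apply_zero] using hconst
  exact A.graph_fst_eq_zero_snd (hgraph t hst) hintegral

theorem IsMildSolution.eq_duhamel (hT : IsC0Semigroup T) (hA : IsGenerator A T)
    (hf : Continuous f) (hw : IsMildSolution A f s w) (hst : s ≤ t) :
    w t = duhamel T s (w s) f t := by
  have hsub := hw.sub hf hf (isMildSolution_duhamel hT hA hf s (w s))
  simp only [sub_self] at hsub
  exact sub_eq_zero.1 (hsub.eq_zero hT hA (by rw [duhamel_self hT, sub_self]) hst)

theorem IsMildSolution.hasDerivWithinAt_semigroup_apply (hT : IsC0Semigroup T)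
    (hA : IsGenerator A T) (hf : Continuous f) (hw : IsMildSolution A f s w) (hsr : s ≤ r)
    (hrt : r < t) :
    HasDerivWithinAt (fun ρ => T (t - ρ)⁺ (w ρ)) (T (t - r)⁺ (f r)) (Ici r) r := by
  have hformula (ρ : ℝ) (hρ : ρ ∈ Icc r t) :
      T (t - ρ)⁺ (w ρ) = T (t - s)⁺ (w s) + ∫ σ in s..ρ, T (t - σ)⁺ (f σ) := by
    have hsρ := hsr.trans hρ.1
    have htρ := sub_nonneg.2 hρ.2
    rw [hw.eq_duhamel hT hA hf hsρ, posPart_of_nonneg htρ,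
      semigroup_apply_duhamel hT hf (w s) hsρ htρ, add_sub_cancel]
  have hc : Continuous fun σ => T (t - σ)⁺ (f σ) := hT.continuous_apply (by fun_prop) hf
  have hderiv := (hc.integral_hasStrictDerivAt s r).hasDerivAt.const_add (T (t - s)⁺ (w s))
  refine hderiv.hasDerivWithinAt.congr_of_eventuallyEq ?_ (hformula r ⟨le_rfl, hrt.le⟩)
  filter_upwards [Icc_mem_nhdsGE hrt] with ρ hρ using hformula ρ hρ

theorem IsRightProduct.hasDerivWithinAt_apply {C E : X →L[𝕜] X} (hE : IsRightProduct A C E)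
    (hf : Continuous f) (hw : IsMildSolution A f s w) :
    HasDerivWithinAt (fun ρ => C (w ρ)) (E (w s) + C (f s)) (Ici s) s := by
  have hformula (ρ : ℝ) (hρ : s ≤ ρ) :
      C (w ρ) = C (w s) + (E (∫ σ in s..ρ, w σ) + C (∫ σ in s..ρ, f σ)) := by
    rw [← hE.apply_of_mem_graph (hw.mem_graph ρ hρ)]
    simp only [map_sub]
    abel
  have hEw := (E.restrictScalars ℝ).hasFDerivAt.comp_hasDerivAt s
    (hw.continuous.integral_hasStrictDerivAt s s).hasDerivAt
  have hCf := (C.restrictScalars ℝ).hasFDerivAt.comp_hasDerivAt s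
    (hf.integral_hasStrictDerivAt s s).hasDerivAt
  exact ((hEw.add hCf).const_add (C (w s))).hasDerivWithinAt.congr hformula (hformula s le_rfl)

theorem IsMildSolution.hasDerivWithinAt_apply (hf : Continuous f) (hw : IsMildSolution A f s w)
    {C : ℝ → X →L[𝕜] X} {C' E : X →L[𝕜] X} (hC : HasDerivAt C C' s)
    (hE : IsRightProduct A (C s) E) :
    HasDerivWithinAt (fun ρ => C ρ (w ρ)) (C' (w s) + (E (w s) + C s (f s))) (Ici s) s := by
  have hincrement : HasDerivWithinAt (fun ρ => (C ρ - C s) (w ρ)) (C' (w s)) (Ici s) s := by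
    rw [← hasDerivWithinAt_Ioi_iff_Ici, hasDerivWithinAt_iff_tendsto_slope' self_notMem_Ioi]
    have hslope := (hasDerivWithinAt_iff_tendsto_slope' self_notMem_Ioi).1
      (hC.hasDerivWithinAt (s := Ioi s))
    have hws : Tendsto w (𝓝[>] s) (𝓝 (w s)) :=
      (hw.continuous.tendsto s).mono_left nhdsWithin_le_nhds
    refine ((isBoundedBilinearMap_apply (𝕜 := 𝕜) (E := X) (F := X)).continuous.tendsto
      (C', w s) |>.comp (hslope.prodMk_nhds hws)).congr fun ρ => ?_
    simp [slope_def_module]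
  exact (hincrement.add (hE.hasDerivWithinAt_apply hf hw)).congr (fun ρ _ => by simp) (by simp)

end Calculus

section Solutions

variable {𝕜 X : Type*} [RCLike 𝕜] [NormedAddCommGroup X] [NormedSpace 𝕜 X] [NormedSpace ℝ X]
  {A : X →ₗ.[𝕜] X} {B : ℝ → X →L[𝕜] X} {s t : ℝ} {y z : ℝ → X}

theorem IsSolution.congr (hy : IsSolution A B s y) (hzy : EqOn z y (Ici s)) :
    IsSolution A B s z := by
  refine ⟨hy.1.congr hzy, fun t ht => ?_⟩
  have hsub (r : ℝ) (hr : r ∈ uIcc s t) : z r = y r := by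
    rw [uIcc_of_le ht] at hr
    exact hzy hr.1
  have hcoeff (r : ℝ) (hr : r ∈ uIcc s t) : B r (z r) = B r (y r) := by rw [hsub r hr]
  rw [hzy ht, hzy self_mem_Ici, intervalIntegral.integral_congr hsub,
    intervalIntegral.integral_congr hcoeff]
  exact hy.2 t ht

theorem IsMildSolution.isSolution (hy : IsMildSolution A (fun r => B r (y r)) s y) :
    IsSolution A B s y :=
  ⟨hy.continuous.continuousOn, hy.mem_graph⟩

theorem IsSolution.isMildSolution (hy : IsSolution A B s y) (hyc : Continuous y) :
    IsMildSolution A (fun r => B r (y r)) s y :=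
  ⟨hyc, hy.2⟩

theorem IsSolution.isMildSolution_clamp (hy : IsSolution A B s y) :
    IsMildSolution A (fun r => B r (y (max r s))) s fun t => y (max t s) :=
  (hy.congr fun _ ht => congrArg y (max_eq_left ht)).isMildSolution
    (hy.1.comp_continuous (by fun_prop) fun t => mem_Ici.2 (le_max_right t s))

theorem IsSolution.mono (hB : Continuous B) (hy : IsSolution A B s y) {a : ℝ} (ha : s ≤ a) :
    IsSolution A B a y := by
  have hclamp := hy.isMildSolution_clamp
  exact (hclamp.mono (hB.clm_apply hclamp.continuous) ha).isSolution.congr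
    fun t ht => congrArg y (max_eq_left (ha.trans ht)).symm

theorem IsSolution.sub (hB : Continuous B) (hy : IsSolution A B s y) (hz : IsSolution A B s z) :
    IsSolution A B s fun t => y t - z t := by
  have hyclamp := hy.isMildSolution_clamp
  have hzclamp := hz.isMildSolution_clamp
  have hsub := hyclamp.sub (hB.clm_apply hyclamp.continuous) (hB.clm_apply hzclamp.continuous)
    hzclamp
  simp only [← map_sub] at hsub
  exact hsub.isSolution.congr fun t ht => by simp only [max_eq_left (mem_Ici.1 ht)]

theorem asymptoticallyStable_of_norm_le {L β : ℝ} (hL : 0 < L) (hβ : β < 0)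
    (hgrowth : ∀ s y, IsSolution A B s y → ∀ t, s ≤ t →
      ‖y t‖ ≤ L * Real.exp (β * (t - s)) * ‖y s‖) : AsymptoticallyStable A B := by
  refine ⟨fun s ε hε => ⟨ε / L, div_pos hε hL, fun y hy hys t ht => ?_⟩, fun s y hy => ?_⟩
  · have hexp : Real.exp (β * (t - s)) ≤ 1 :=
      Real.exp_le_one_iff.2 (mul_nonpos_of_nonpos_of_nonneg hβ.le (sub_nonneg.2 ht))
    calc ‖y t‖ ≤ L * Real.exp (β * (t - s)) * ‖y s‖ := hgrowth s y hy t ht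
      _ ≤ L * 1 * ‖y s‖ := by gcongr
      _ < L * 1 * (ε / L) := by gcongr
      _ = ε := by field_simp
  · have hexponent : Tendsto (fun t => β * (t - s)) atTop atBot :=
      (tendsto_atTop_add_const_right _ (-s) tendsto_id).const_mul_atTop_of_neg hβ
    have hbound : Tendsto (fun t => L * Real.exp (β * (t - s)) * ‖y s‖) atTop (𝓝 0) := by
      simpa using ((Real.tendsto_exp_atBot.comp hexponent).const_mul L).mul_const ‖y s‖
    refine squeeze_zero_norm' ?_ hbound
    filter_upwards [eventually_ge_atTop s] with t ht using hgrowth s y hy t ht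

theorem IsSolution.const_smul (c : 𝕜) (hy : IsSolution A B s y) :
    IsSolution A B s fun t => c • y t := by
  refine ⟨hy.1.const_smul c, fun t ht => ?_⟩
  simp only [map_smul, intervalIntegral.integral_smul, ← smul_sub]
  exact A.graph.smul_mem c (hy.2 t ht)

theorem IsSolution.add (hB : Continuous B) (hy : IsSolution A B s y) (hz : IsSolution A B s z) :
    IsSolution A B s fun t => y t + z t := by
  simpa using hy.sub hB (hz.const_smul (-1 : 𝕜))

variable [CompleteSpace X] {T : ℝ → X →L[𝕜] X}

theorem exists_forall_isSolution_norm_le (hT : IsC0Semigroup T) (hA : IsGenerator A T)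
    (hB : Continuous B) (hst : s ≤ t) :
    ∃ L, ∀ y, IsSolution A B s y → ‖y t‖ ≤ L * ‖y s‖ := by
  obtain ⟨κ, hκ⟩ := hT.exists_norm_posPart_le (t - s)
  obtain ⟨b, hb⟩ := (isCompact_Icc (a := s) (b := t)).exists_bound_of_continuousOn hB.continuousOn
  have hκ0 : 0 ≤ κ := (norm_nonneg _).trans (hκ _ le_rfl)
  have hb0 : 0 ≤ b := (norm_nonneg _).trans (hb s ⟨le_rfl, hst⟩)
  refine ⟨κ * Real.exp (κ * b * (t - s)), fun y hy => ?_⟩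
  wlog hyc : Continuous y generalizing y
  · simpa only [max_self, max_eq_left hst] using
      this _ hy.isMildSolution_clamp.isSolution hy.isMildSolution_clamp.continuous
  have hf : Continuous fun r => B r (y r) := hB.clm_apply hyc
  have hgronwall : ‖y t‖ ≤ κ * ‖y s‖ * Real.exp (κ * b * (t - s)) := by
    refine le_mul_exp_of_le_add_mul_integral hyc.norm (fun _ => norm_nonneg _)
      (mul_nonneg hκ0 hb0) hst fun r hr => ?_
    rw [(hy.isMildSolution hyc).eq_duhamel hT hA hf hr.1, duhamel,
      ← intervalIntegral.integral_const_mul]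
    refine (norm_add_le _ _).trans (add_le_add
      ((T _).le_of_opNorm_le (hκ _ (by linarith [hr.2])) _) ?_)
    refine intervalIntegral.norm_integral_le_of_norm_le hr.1
      (MeasureTheory.ae_of_all _ fun σ hσ => ?_)
      ((hyc.norm.const_mul (κ * b)).intervalIntegrable _ _)
    calc ‖T (r - σ)⁺ (B σ (y σ))‖ ≤ κ * ‖B σ (y σ)‖ :=
          (T _).le_of_opNorm_le (hκ _ (by linarith [hr.2, hσ.1])) _
      _ ≤ κ * (b * ‖y σ‖) := by
          gcongr; exact (B σ).le_of_opNorm_le (hb σ ⟨hσ.1.le, hσ.2.trans hr.2⟩) _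
      _ = κ * b * ‖y σ‖ := (mul_assoc _ _ _).symm
  exact hgronwall.trans_eq (by ring)

theorem IsSolution.eqOn (hT : IsC0Semigroup T) (hA : IsGenerator A T) (hB : Continuous B)
    (hy : IsSolution A B s y) (hz : IsSolution A B s z) (hyz : y s = z s) : EqOn y z (Ici s) := by
  intro t ht
  obtain ⟨L, hL⟩ := exists_forall_isSolution_norm_le hT hA hB ht
  have hdiff := hL _ (hy.sub hB hz)
  simp only [hyz, sub_self, norm_zero, mul_zero] at hdiff
  exact sub_eq_zero.1 (norm_le_zero_iff.1 hdiff)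

end Solutions

section Existence

theorem continuous_intervalIntegral_of_continuous {Y E : Type*} [TopologicalSpace Y]
    [FirstCountableTopology Y] [LocallyCompactSpace Y] [NormedAddCommGroup E] [NormedSpace ℝ E]
    {a b : Y → ℝ} {F : Y → ℝ → E} (ha : Continuous a) (hb : Continuous b)
    (hF : Continuous (Function.uncurry F)) : Continuous fun p => ∫ r in a p..b p, F p r := by
  have hF_int (p : Y) (c : ℝ) : IntervalIntegrable (F p) MeasureTheory.volume 0 c :=
    (hF.comp (Continuous.prodMk_right p)).intervalIntegrable 0 c
  simp only [← fun p => intervalIntegral.integral_interval_sub_left (hF_int p (b p))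
    (hF_int p (a p))]
  exact (intervalIntegral.continuous_parametric_intervalIntegral_of_continuous hF hb).sub
    (intervalIntegral.continuous_parametric_intervalIntegral_of_continuous hF ha)

variable {𝕜 X : Type*} [RCLike 𝕜] [NormedAddCommGroup X] [NormedSpace 𝕜 X] [NormedSpace ℝ X]

/-- The `n`-th term, as a function of `t`, of the Dyson series for the solution of
`y' = A y + B(t) y`, `y(s) = x`: the `n`-th correction in Picard's iteration for Duhamel's
formula. -/
noncomputable def dysonTerm (T B : ℝ → X →L[𝕜] X) (s : ℝ) (x : X) : ℕ → ℝ → X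
  | 0, t => T (t - s)⁺ x
  | n + 1, t => ∫ r in s..t, T (t - r)⁺ (B r (dysonTerm T B s x n r))

/-- The Dyson series, the candidate for the solution of `y' = A y + B(t) y`, `y(s) = x`. -/
noncomputable def dysonSeries (T B : ℝ → X →L[𝕜] X) (s : ℝ) (x : X) (t : ℝ) : X :=
  ∑' n, dysonTerm T B s x n t

variable {T B : ℝ → X →L[𝕜] X} {s t : ℝ}

theorem norm_dysonTerm_le {I : Set ℝ} [I.OrdConnected] {κ b : ℝ}
    (hκ : ∀ t ∈ I, ∀ r ∈ I, ‖T (t - r)⁺‖ ≤ κ) (hb : ∀ r ∈ I, ‖B r‖ ≤ b) (hs : s ∈ I) (x : X)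
    (n : ℕ) (ht : t ∈ I) :
    ‖dysonTerm T B s x n t‖ ≤ κ * ‖x‖ * ((κ * b * |t - s|) ^ n / n.factorial) := by
  have hκ0 : 0 ≤ κ := (norm_nonneg _).trans (hκ s hs s hs)
  have hb0 : 0 ≤ b := (norm_nonneg _).trans (hb s hs)
  induction n generalizing t with
  | zero => simpa [dysonTerm] using (T _).le_of_opNorm_le (hκ t ht s hs) x
  | succ n ih =>
    let c : ℝ := κ * b * (κ * ‖x‖ * ((κ * b) ^ n / n.factorial))
    have hintegrand (r : ℝ) (hr : r ∈ uIoc s t) :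
        ‖T (t - r)⁺ (B r (dysonTerm T B s x n r))‖ ≤ c * |r - s| ^ n := by
      have hrI : r ∈ I := OrdConnected.uIcc_subset ‹_› hs ht (uIoc_subset_uIcc hr)
      calc ‖T (t - r)⁺ (B r (dysonTerm T B s x n r))‖
          ≤ κ * (b * (κ * ‖x‖ * ((κ * b * |r - s|) ^ n / n.factorial))) :=
            (T _).le_of_opNorm_le_of_le (hκ t ht r hrI)
              ((B r).le_of_opNorm_le_of_le (hb r hrI) (ih hrI))
        _ = c * |r - s| ^ n := by simp only [c, mul_pow (κ * b)]; ring
    calc ‖dysonTerm T B s x (n + 1) t‖ ≤ |∫ r in s..t, c * |r - s| ^ n| :=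
          intervalIntegral.norm_integral_le_abs_of_norm_le
            ((MeasureTheory.ae_restrict_mem measurableSet_uIoc).mono hintegrand)
            (Continuous.intervalIntegrable (by fun_prop) _ _)
      _ = c * (|t - s| ^ (n + 1) / (n + 1)) := by
          rw [intervalIntegral.integral_const_mul, abs_mul,
            intervalIntegral.abs_intervalIntegral_eq, integral_pow_abs_sub_uIoc,
            abs_of_nonneg (by positivity), abs_of_nonneg (by positivity)]
      _ = κ * ‖x‖ * ((κ * b * |t - s|) ^ (n + 1) / (n + 1).factorial) := by
          rw [Nat.factorial_succ, mul_pow (κ * b)]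
          push_cast
          simp only [c]
          field_simp
          ring

variable [CompleteSpace X]

theorem exists_summable_norm_dysonTerm_le (hT : IsC0Semigroup T) (hB : Continuous B) (R : ℝ)
    (x : X) : ∃ c : ℕ → ℝ, Summable c ∧ ∀ n, ∀ s ∈ Icc (-R) R, ∀ t ∈ Icc (-R) R,
      ‖dysonTerm T B s x n t‖ ≤ c n := by
  obtain ⟨κ, hκ⟩ := hT.exists_norm_posPart_le (2 * R)
  obtain ⟨b, hb⟩ := (isCompact_Icc (a := -R) (b := R)).exists_bound_of_continuousOn hB.continuousOn
  refine ⟨fun n => κ * ‖x‖ * ((κ * b * (2 * R)) ^ n / n.factorial),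
    (Real.summable_pow_div_factorial _).mul_left _, fun n s hs t ht => ?_⟩
  have hκ0 : 0 ≤ κ := (norm_nonneg _).trans (hκ _ le_rfl)
  have hb0 : 0 ≤ b := (norm_nonneg _).trans (hb s hs)
  have hts : |t - s| ≤ 2 * R := by grind
  refine (norm_dysonTerm_le (fun t ht r hr => hκ _ (by linarith [ht.2, hr.1]))
    hb hs x n ht).trans ?_
  dsimp only
  gcongr

theorem summable_dysonTerm (hT : IsC0Semigroup T) (hB : Continuous B) (s : ℝ) (x : X) (t : ℝ) :
    Summable fun n => dysonTerm T B s x n t := by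
  obtain ⟨c, hc, hbound⟩ := exists_summable_norm_dysonTerm_le hT hB (max |s| |t|) x
  exact hc.of_norm_bounded fun n =>
    hbound n s (abs_le.1 (le_max_left _ _)) t (abs_le.1 (le_max_right _ _))

theorem continuous_dysonTerm (hT : IsC0Semigroup T) (hB : Continuous B) (x : X) (n : ℕ) :
    Continuous fun p : ℝ × ℝ => dysonTerm T B p.2 x n p.1 := by
  induction n with
  | zero => exact hT.continuous_apply (by fun_prop) continuous_const
  | succ n ih =>
    exact continuous_intervalIntegral_of_continuous continuous_snd continuous_fst
      (hT.continuous_apply (by fun_prop) ((hB.comp continuous_snd).clm_apply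
        (ih.comp (continuous_snd.prodMk (continuous_snd.comp continuous_fst)))))

theorem continuous_dysonSeries (hT : IsC0Semigroup T) (hB : Continuous B) (x : X) :
    Continuous fun p : ℝ × ℝ => dysonSeries T B p.2 x p.1 := by
  refine continuous_iff_continuousAt.2 fun p => ?_
  let R : ℝ := max |p.1| |p.2| + 1
  have hmem {a : ℝ} (ha : |a| ≤ max |p.1| |p.2|) : Icc (-R) R ∈ 𝓝 a := by
    have := abs_lt.1 (ha.trans_lt (lt_add_one _))
    exact Icc_mem_nhds this.1 this.2
  obtain ⟨c, hc, hbound⟩ := exists_summable_norm_dysonTerm_le hT hB R x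
  exact (continuousOn_tsum (fun n => (continuous_dysonTerm hT hB x n).continuousOn) hc
    fun n q hq => hbound n q.2 hq.2 q.1 hq.1).continuousAt
      (prod_mem_nhds (hmem (le_max_left _ _)) (hmem (le_max_right _ _)))

theorem dysonSeries_eq_duhamel (hT : IsC0Semigroup T) (hB : Continuous B) (s : ℝ) (x : X) :
    dysonSeries T B s x = duhamel T s x fun r => B r (dysonSeries T B s x r) := by
  funext t
  let R : ℝ := max |s| |t|
  have hs : s ∈ Icc (-R) R := abs_le.1 (le_max_left _ _)
  have ht : t ∈ Icc (-R) R := abs_le.1 (le_max_right _ _)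
  obtain ⟨c, hc, hbound⟩ := exists_summable_norm_dysonTerm_le hT hB R x
  obtain ⟨κ, hκ⟩ := hT.exists_norm_posPart_le (2 * R)
  obtain ⟨b, hb⟩ := (isCompact_Icc (a := -R) (b := R)).exists_bound_of_continuousOn hB.continuousOn
  rw [dysonSeries, (summable_dysonTerm hT hB s x t).tsum_eq_zero_add, duhamel]
  congr 1
  refine (intervalIntegral.hasSum_integral_of_dominated_convergence
    (fun n _ => κ * (b * c n)) (fun n => ?_) (fun n => ?_)
    (MeasureTheory.ae_of_all _ fun _ _ => (hc.mul_left b).mul_left κ)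
    intervalIntegrable_const
    (MeasureTheory.ae_of_all _ fun r _ => ?_)).tsum_eq
  · exact (hT.continuous_apply (by fun_prop) (hB.clm_apply ((continuous_dysonTerm hT hB x n).comp
      (Continuous.prodMk_left s)))).aestronglyMeasurable
  · refine MeasureTheory.ae_of_all _ fun r hr => ?_
    have hrI : r ∈ Icc (-R) R := OrdConnected.uIcc_subset ordConnected_Icc hs ht
      (uIoc_subset_uIcc hr)
    exact (T _).le_of_opNorm_le_of_le (hκ _ (by linarith [ht.2, hrI.1]))
      ((B r).le_of_opNorm_le_of_le (hb r hrI) (hbound n s hs r hrI))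
  · exact (T _).hasSum ((B r).hasSum (summable_dysonTerm hT hB s x r).hasSum)

theorem dysonSeries_self (hT : IsC0Semigroup T) (hB : Continuous B) (s : ℝ) (x : X) :
    dysonSeries T B s x s = x := by
  rw [dysonSeries_eq_duhamel hT hB, duhamel_self hT]

theorem isSolution_dysonSeries {A : X →ₗ.[𝕜] X} (hT : IsC0Semigroup T)
    (hA : IsGenerator A T) (hB : Continuous B) (s : ℝ) (x : X) :
    IsSolution A B s (dysonSeries T B s x) := by
  have hf : Continuous fun r => B r (dysonSeries T B s x r) :=
    hB.clm_apply ((continuous_dysonSeries hT hB x).comp (Continuous.prodMk_left s))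
  have hmild := isMildSolution_duhamel hT hA hf s x
  rw [← dysonSeries_eq_duhamel hT hB] at hmild
  exact hmild.isSolution

end Existence

section EvolutionOperator

variable {𝕜 X : Type*} [RCLike 𝕜] [NormedAddCommGroup X] [NormedSpace 𝕜 X] [NormedSpace ℝ X]
  {A : X →ₗ.[𝕜] X} {B : ℝ → X →L[𝕜] X} {S S' : ℝ → ℝ → X →L[𝕜] X} {s t : ℝ}

theorem IsEvolutionOperator.norm_le (hS : IsEvolutionOperator A B S) {c : ℝ} (hc : 0 ≤ c)
    (hgrowth : ∀ y, IsSolution A B s y → ‖y t‖ ≤ c * ‖y s‖) : ‖S t s‖ ≤ c := by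
  refine (S t s).opNorm_le_bound hc fun x => ?_
  simpa [hS.self] using hgrowth _ (hS.isSolution s x)

variable [CompleteSpace X] {T : ℝ → X →L[𝕜] X}

theorem IsEvolutionOperator.eq_of_le (hT : IsC0Semigroup T) (hA : IsGenerator A T)
    (hB : Continuous B) (hS : IsEvolutionOperator A B S) (hS' : IsEvolutionOperator A B S')
    (hst : s ≤ t) : S' t s = S t s := by
  ext x
  exact (hS'.isSolution s x).eqOn hT hA hB (hS.isSolution s x) (by simp [hS.self, hS'.self]) hst

theorem exists_forall_apply_eq_dysonSeries (hT : IsC0Semigroup T) (hA : IsGenerator A T)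
    (hB : Continuous B) (hst : s ≤ t) : ∃ U : X →L[𝕜] X, ∀ x, U x = dysonSeries T B s x t := by
  have hsol (x : X) := isSolution_dysonSeries hT hA hB s x
  have hself (x : X) := dysonSeries_self hT hB s x
  obtain ⟨L, hL⟩ := exists_forall_isSolution_norm_le hT hA hB hst
  let U : X →ₗ[𝕜] X :=
    { toFun := fun x => dysonSeries T B s x t
      map_add' := fun x x' => (hsol (x + x')).eqOn hT hA hB ((hsol x).add hB (hsol x'))
        (by simp only [hself]) hst
      map_smul' := fun c x => (hsol (c • x)).eqOn hT hA hB ((hsol x).const_smul c)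
        (by simp only [hself]) hst }
  have hU (x : X) : ‖U x‖ ≤ L * ‖x‖ := (hL _ (hsol x)).trans_eq (by rw [hself])
  exact ⟨U.mkContinuous L hU, fun _ => rfl⟩

theorem exists_isEvolutionOperator (hT : IsC0Semigroup T) (hA : IsGenerator A T)
    (hB : Continuous B) : ∃ S : ℝ → ℝ → X →L[𝕜] X, IsEvolutionOperator A B S := by
  have hex (t s : ℝ) (hst : s ≤ t) := exists_forall_apply_eq_dysonSeries hT hA hB hst
  choose! S hS using hex
  have hsol (s : ℝ) (x : X) : IsSolution A B s fun t => S t s x :=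
    (isSolution_dysonSeries hT hA hB s x).congr fun t ht => hS t s ht x
  have hself (s : ℝ) (x : X) : S s s x = x := by rw [hS s s le_rfl, dysonSeries_self hT hB]
  refine ⟨S, fun s => ContinuousLinearMap.ext (hself s), fun s r t hsr hrt => ?_, fun x => ?_, hsol⟩
  · ext x
    exact (hsol r (S r s x)).eqOn hT hA hB ((hsol s x).mono hB hsr) (hself r _) hrt
  · exact (continuous_dysonSeries hT hB x).continuousOn.congr fun p hp => hS p.1 p.2 hp x

end EvolutionOperator

section Growth

variable {𝕜 X : Type*} [RCLike 𝕜] [NormedAddCommGroup X] [NormedSpace 𝕜 X] [NormedSpace ℝ X]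

/-- The averaging defect `A C - C A - C B(u)`, `C = C_t(u)`, exists as a bounded operator and has
norm at most `ν`. It measures how far `(I - C_t(u)) y(u)` is from obeying `w' = A w` along a
solution `y`. -/
def AveragingDefectLE (A : X →ₗ.[𝕜] X) (B : ℝ → X →L[𝕜] X) (t u ν : ℝ) : Prop :=
  ∃ D E : X →L[𝕜] X, IsLeftProduct A (primitive B t u) D ∧ IsRightProduct A (primitive B t u) E ∧
    ‖D - E - (primitive B t u).comp (B u)‖ ≤ ν

variable {A : X →ₗ.[𝕜] X} {T B : ℝ → X →L[𝕜] X} {K α δ ν h s r t : ℝ} {y : ℝ → X}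

theorem averagingDefectLE_of_norm_le {t u c : ℝ} (hCB : ‖(primitive B t u).comp (B u)‖ ≤ c)
    (hCA : ∃ E : X →L[𝕜] X, IsRightProduct A (primitive B t u) E ∧ ‖E‖ ≤ c)
    (hAC : ∃ D : X →L[𝕜] X, IsLeftProduct A (primitive B t u) D ∧ ‖D‖ ≤ c) :
    AveragingDefectLE A B t u (3 * c) := by
  obtain ⟨E, hE, hEc⟩ := hCA
  obtain ⟨D, hD, hDc⟩ := hAC
  refine ⟨D, E, hD, hE, ?_⟩
  calc ‖D - E - (primitive B t u).comp (B u)‖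
      ≤ ‖D‖ + ‖E‖ + ‖(primitive B t u).comp (B u)‖ := norm_sub_le_of_le (norm_sub_le D E) le_rfl
    _ ≤ 3 * c := by linarith

variable [CompleteSpace X]

theorem hasDerivAt_primitive (hB : Continuous B) (t u : ℝ) :
    HasDerivAt (primitive B t) (B u) u :=
  (hB.integral_hasStrictDerivAt t u).hasDerivAt

theorem continuous_primitive (hB : Continuous B) (t : ℝ) : Continuous (primitive B t) :=
  continuous_iff_continuousAt.2 fun u => (hasDerivAt_primitive hB t u).continuousAt

theorem IsSolution.hasDerivWithinAt_semigroup_apply_sub (hT : IsC0Semigroup T)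
    (hA : IsGenerator A T) (hB : Continuous B) (hy : IsSolution A B s y) (hyc : Continuous y)
    (hsr : s ≤ r) (hrt : r < t) {D E : X →L[𝕜] X} (hD : IsLeftProduct A (primitive B t r) D)
    (hE : IsRightProduct A (primitive B t r) E) :
    HasDerivWithinAt (fun ρ => T (t - ρ)⁺ (y ρ - primitive B t ρ (y ρ)))
      (T (t - r)⁺ ((D - E - (primitive B t r).comp (B r)) (y r))) (Ici r) r := by
  have hf : Continuous fun ρ => B ρ (y ρ) := hB.clm_apply hyc
  have hmild := hy.isMildSolution hyc
  have hyder := hmild.hasDerivWithinAt_semigroup_apply hT hA hf hsr hrt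
  have hCyder := hA.hasDerivWithinAt_semigroup_apply hT hrt
    ((hmild.mono hf hsr).hasDerivWithinAt_apply hf (hasDerivAt_primitive hB t r) hE) (hD (y r))
  simp only [map_sub]
  refine (hyder.sub hCyder).congr_deriv ?_
  rw [← map_sub]
  congr 1
  simp only [sub_apply, ContinuousLinearMap.comp_apply]
  abel

theorem IsSolution.norm_le_add_integral (hT : IsC0Semigroup T) (hA : IsGenerator A T)
    (hTK : ∀ t, 0 ≤ t → ‖T t‖ ≤ K * Real.exp (α * t)) (hB : Continuous B) (hst : s ≤ t)
    (hC : ‖primitive B t s‖ ≤ δ) (hdefect : ∀ r ∈ Ico s t, AveragingDefectLE A B t r ν)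
    (hy : IsSolution A B s y) (hyc : Continuous y) :
    ‖y t‖ ≤ (1 + δ) * K * ‖y s‖ * Real.exp (α * (t - s)) +
      K * ν * ∫ r in s..t, Real.exp (α * (t - r)) * ‖y r‖ := by
  choose! D E hD hE hDE using hdefect
  have hTr (r : ℝ) (hr : r ≤ t) : ‖T (t - r)⁺‖ ≤ K * Real.exp (α * (t - r)) := by
    rw [posPart_of_nonneg (sub_nonneg.2 hr)]
    exact hTK _ (sub_nonneg.2 hr)
  have hcont : Continuous fun ρ => T (t - ρ)⁺ (y ρ - primitive B t ρ (y ρ)) :=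
    hT.continuous_apply (by fun_prop) (hyc.sub ((continuous_primitive hB t).clm_apply hyc))
  have hinitial : ‖T (t - s)⁺ (y s - primitive B t s (y s))‖ ≤
      (1 + δ) * K * ‖y s‖ * Real.exp (α * (t - s)) := by
    have hsub : ‖y s - primitive B t s (y s)‖ ≤ ‖y s‖ + δ * ‖y s‖ :=
      norm_sub_le_of_le le_rfl ((primitive B t s).le_of_opNorm_le hC _)
    exact ((T _).le_of_opNorm_le_of_le (hTr s hst) hsub).trans_eq (by ring)
  have hderiv (r : ℝ) (hr : r ∈ Ico s t) :
      ‖T (t - r)⁺ ((D r - E r - (primitive B t r).comp (B r)) (y r))‖ ≤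
        K * ν * (Real.exp (α * (t - r)) * ‖y r‖) :=
    ((T _).le_of_opNorm_le_of_le (hTr r hr.2.le)
      ((D r - E r - _).le_of_opNorm_le (hDE r hr) (y r))).trans_eq (by ring)
  have hexp : Continuous fun r => Real.exp (α * (t - r)) * ‖y r‖ := by fun_prop
  have hbound := image_norm_le_of_norm_deriv_right_le_deriv_boundary (B := fun u =>
      (1 + δ) * K * ‖y s‖ * Real.exp (α * (t - s)) +
        K * ν * ∫ r in s..u, Real.exp (α * (t - r)) * ‖y r‖)
    hcont.continuousOn
    (fun r hr => hy.hasDerivWithinAt_semigroup_apply_sub hT hA hB hyc hr.1 hr.2 (hD r hr) (hE r hr))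
    (by simpa using hinitial)
    (fun r => ((hexp.integral_hasStrictDerivAt s r).hasDerivAt.const_mul _).const_add _)
    hderiv (x := t) ⟨hst, le_rfl⟩
  simpa [hT.apply_zero, primitive] using hbound

theorem IsSolution.norm_le_of_sub_le (hT : IsC0Semigroup T) (hA : IsGenerator A T)
    (hTK : ∀ t, 0 ≤ t → ‖T t‖ ≤ K * Real.exp (α * t)) (hB : Continuous B)
    (hC : ∀ t, ∀ u ∈ Icc (t - h) t, ‖primitive B t u‖ ≤ δ)
    (hdefect : ∀ t, ∀ u ∈ Icc (t - h) t, AveragingDefectLE A B t u ν)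
    (hy : IsSolution A B s y) (hst : s ≤ t) (hth : t - s ≤ h) :
    ‖y t‖ ≤ (1 + δ) * K * Real.exp ((α + K * ν) * (t - s)) * ‖y s‖ := by
  wlog hyc : Continuous y generalizing y
  · simpa only [max_self, max_eq_left hst] using
      this hy.isMildSolution_clamp.isSolution hy.isMildSolution_clamp.continuous
  have hK : 0 ≤ K := by simpa using (norm_nonneg _).trans (hTK 0 le_rfl)
  have hν : 0 ≤ ν := by
    obtain ⟨D, E, -, -, hDE⟩ := hdefect t s ⟨by linarith, hst⟩
    exact (norm_nonneg _).trans hDE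
  have hgronwall := le_mul_exp_of_le_exp_add_mul_integral_exp hyc.norm (fun _ => norm_nonneg _)
    (mul_nonneg hK hν) hst fun r hr => hy.norm_le_add_integral hT hA hTK hB hr.1
      (hC r s ⟨by linarith [hr.2], hr.1⟩)
      (fun u hu => hdefect r u ⟨by linarith [hu.1, hr.2], hu.2.le⟩) hyc
  exact hgronwall.trans_eq (by ring)

theorem IsSolution.norm_le_exp (hT : IsC0Semigroup T) (hA : IsGenerator A T) (hK : 1 ≤ K)
    (hTK : ∀ t, 0 ≤ t → ‖T t‖ ≤ K * Real.exp (α * t)) (hB : Continuous B) (hh : 0 < h)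
    (hC : ∀ t, ∀ u ∈ Icc (t - h) t, ‖primitive B t u‖ ≤ δ)
    (hdefect : ∀ t, ∀ u ∈ Icc (t - h) t, AveragingDefectLE A B t u ν)
    (hy : IsSolution A B s y) (hst : s ≤ t) :
    ‖y t‖ ≤ (1 + δ) * K *
      Real.exp ((α + K * ν + Real.log ((1 + δ) * K) / h) * (t - s)) * ‖y s‖ := by
  have hδ : 0 ≤ δ := (norm_nonneg _).trans (hC s s ⟨by linarith, le_rfl⟩)
  have hL : 1 ≤ (1 + δ) * K := one_le_mul_of_one_le_of_one_le (by linarith) hK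
  exact le_mul_exp_of_short_steps (v := fun r => ‖y r‖) hL hh (norm_nonneg _)
    (fun a r hsa har hrh => (hy.mono hB hsa).norm_le_of_sub_le hT hA hTK hB hC hdefect har hrh) hst

end Growth

end EvolutionStability

theorem mainTheorem3_general {𝕜 X : Type*} [RCLike 𝕜] [NormedAddCommGroup X] [NormedSpace 𝕜 X]
    [NormedSpace ℝ X] [CompleteSpace X] {A : X →ₗ.[𝕜] X}
    {T : ℝ → X →L[𝕜] X} (hT : IsC0Semigroup T) (hA : IsGenerator A T) {K α : ℝ} (hK : 1 ≤ K)
    (hTK : ∀ t, 0 ≤ t → ‖T t‖ ≤ K * Real.exp (α * t)) {B : ℝ → X →L[𝕜] X} (hB : Continuous B)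
    {h δ ν : ℝ} (hh : 0 < h) (hC : ∀ t, ∀ u ∈ Icc (t - h) t, ‖primitive B t u‖ ≤ δ)
    (hdefect : ∀ t, ∀ u ∈ Icc (t - h) t, AveragingDefectLE A B t u ν) {β : ℝ}
    (hβ : β = α + K * ν + Real.log ((1 + δ) * K) / h) :
    ∃ S : ℝ → ℝ → X →L[𝕜] X,
      IsEvolutionOperator A B S ∧
      (∀ S' : ℝ → ℝ → X →L[𝕜] X, IsEvolutionOperator A B S' →
        ∀ s t, s ≤ t → S' t s = S t s) ∧
      (∀ s t, s ≤ t → ‖S t s‖ ≤ (1 + δ) * K * Real.exp (β * (t - s))) ∧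
      (β < 0 → AsymptoticallyStable A B) := by
  have hδ : 0 ≤ δ := (norm_nonneg _).trans (hC 0 0 ⟨by linarith, le_rfl⟩)
  have hgrowth (s : ℝ) (y : ℝ → X) (hy : IsSolution A B s y) (t : ℝ) (hst : s ≤ t) :
      ‖y t‖ ≤ (1 + δ) * K * Real.exp (β * (t - s)) * ‖y s‖ :=
    hβ ▸ hy.norm_le_exp hT hA hK hTK hB hh hC hdefect hst
  obtain ⟨S, hS⟩ := exists_isEvolutionOperator hT hA hB
  exact ⟨S, hS, fun S' hS' s t hst => hS.eq_of_le hT hA hB hS' hst,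
    fun s t hst => hS.norm_le (by positivity) fun y hy => hgrowth s y hy t hst,
    fun hneg => asymptoticallyStable_of_norm_le (by positivity) hneg hgrowth⟩

theorem mainTheorem3 {𝕜 X : Type*} [RCLike 𝕜] [NormedAddCommGroup X] [NormedSpace 𝕜 X]
    [NormedSpace ℝ X] [IsScalarTower ℝ 𝕜 X] [CompleteSpace X]
    (A : X →ₗ.[𝕜] X) (T : ℝ → X →L[𝕜] X) (hT : IsC0Semigroup T) (hA : IsGenerator A T)
    (K α : ℝ) (hK : 1 ≤ K) (hTK : ∀ t, 0 ≤ t → ‖T t‖ ≤ K * Real.exp (α * t))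
    (B : ℝ → X →L[𝕜] X) (hB : Continuous B)
    (hAB : ∀ t, ∃ D : X →L[𝕜] X, IsLeftProduct A (B t) D)
    (hBA : ∀ t, ∃ E : X →L[𝕜] X, IsRightProduct A (B t) E)
    (h M δ : ℝ) (hh : 0 < h) (hM : 0 < M) (hδ : 0 < δ)
    (hC : ∀ t u, |u - t| ≤ h → ‖primitive B t u‖ ≤ δ)
    (hCB : ∀ t u, |u - t| ≤ h → ‖(primitive B t u).comp (B u)‖ ≤ M * δ)
    (hCA : ∀ t u, |u - t| ≤ h →
      ∃ E : X →L[𝕜] X, IsRightProduct A (primitive B t u) E ∧ ‖E‖ ≤ M * δ)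
    (hAC : ∀ t u, |u - t| ≤ h →
      ∃ D : X →L[𝕜] X, IsLeftProduct A (primitive B t u) D ∧ ‖D‖ ≤ M * δ)
    (β : ℝ) (hβ : β = α + 3 * M * K * δ + Real.log ((1 + δ) * K) / h) :
    ∃ S : ℝ → ℝ → X →L[𝕜] X,
      IsEvolutionOperator A B S ∧
      (∀ S' : ℝ → ℝ → X →L[𝕜] X, IsEvolutionOperator A B S' →
        ∀ s t, s ≤ t → S' t s = S t s) ∧
      (∀ s t, s ≤ t → ‖S t s‖ ≤ (1 + δ) * K * Real.exp (β * (t - s))) ∧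
      (β < 0 → AsymptoticallyStable A B) := by
  have hIcc {t u : ℝ} (hu : u ∈ Icc (t - h) t) : |u - t| ≤ h :=
    abs_le.2 ⟨by linarith [hu.1], by linarith [hu.2]⟩
  exact mainTheorem3_general hT hA hK hTK hB hh (fun t u hu => hC t u (hIcc hu))
    (fun t u hu => averagingDefectLE_of_norm_le (hCB t u (hIcc hu)) (hCA t u (hIcc hu))
      (hAC t u (hIcc hu))) (hβ.trans (by ring))
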